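/- Conventions. A \emph{partially ordered group} $(\Gamma,\le)$ is a (not necessarily commutative, additively written) group with a partial order such that $\alpha\le\gamma$ and $\beta\le\delta$ imply $\alpha+\beta\le\gamma+\delta$. Let $D$ be a division ring, $N\le D^\times$ a subgroup and $\varphi\colon N\to\Gamma$ a group homomorphism to a partially ordered group. Put $N_{>\alpha}=\{x\in N:\varphi(x)>\alpha\}$ and $N_{\le\alpha}=\{x\in N:\varphi(x)\le\alpha\}$. The map $\varphi$ is \emph{strongly leveled} if there is $\alpha\in\Gamma$, $\alpha\ge 0$ (an \emph{s-level} of $\varphi$), such that $N_{>\alpha}\neq\emptyset$ and $1\pm N_{>\alpha}\subseteq N_{\le 0}$. It is \emph{strong valuation-like} if moreover $\Gamma$ is totally ordered. A \emph{valuation} of a field $k$ is a surjective group homomorphism $v\colon k^\times\to\Gamma_v$ onto a totally ordered (commutative) group such that $v(x+y)\ge\min\{v(x),v(y)\}$ whenever $x+y\ne 0$. Its \emph{height} is the supremum of all $r\ge 0$ for which there is a chain $\Gamma_v=\Gamma_0\to\Gamma_1\to\cdots\to\Gamma_r=\{0\}$ of epimorphisms of totally ordered groups, all with non-trivial kernels.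 The \emph{$v$-adic topology} on $k$ is the ring topology in which the sets $\{x\in k^\times: v(x)>\delta\}\cup\{0\}$, $\delta\in\Gamma_v$, $\delta\ge0$, form a basis of neighbourhoods of $0$; $k^\times$ carries the subspace topology. For a subgroup $M\le k^\times$ and a homomorphism $\psi\colon M\to\Gamma$, the valuation $v$ is \emph{associated} with $\psi$ if $\psi(m)\ge 0$ implies $v(m)\ge 0$ for all $m\in M$. \textbf{Theorem.} Let $D$ be a finite-dimensional (not necessarily central) division algebra over a field $k$ that has finite transcendence degree over its prime field, and let $N\subseteq D^\times$ be a normal subgroup of finite index containing $-1$. Let $\varphi\colon N\to\Gamma$ be a strongly leveled map to a partially ordered group $(\Gamma,\le)$ such that the subgroup $\varphi(N\cap k^\times)$ of $\Gamma$ is totally ordered. Then: (a) the restriction $\varphi_k=\varphi|_{N\cap k^\times}$, regarded as a map to the totally ordered group $\varphi(N\cap k^\times)$, is a strong valuation-like map (in particular it has an s-level in $\varphi(N\cap k^\times)$); (b) there exists a height one valuation $v$ of $k$ associated with $\varphi_k$ such that $N\cap k^\times$ is open in $k^\times$ in the $v$-adic topology. -/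

import Mathlib

universe u v w

namespace LeveledMap

section Levels

variable {D : Type*} [DivisionRing D] {N : Subgroup Dˣ} {Γ : Type*} [AddGroup Γ] [PartialOrder Γ]

/-- `N_{> α} = {x ∈ N | φ x > α}`, viewed as a subset of the division ring `D`.
The group `N` is written multiplicatively and `Γ` additively, so that a homomorphism from `N`
to `Γ` is a map `Additive N →+ Γ`. -/
def levelGT (φ : Additive N →+ Γ) (α : Γ) : Set D :=
  {x | ∃ n : N, ((n : Dˣ) : D) = x ∧ α < φ (Additive.ofMul n)}

/-- `N_{≤ α} = {x ∈ N | φ x ≤ α}`, viewed as a subset of the division ring `D`. -/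
def levelLE (φ : Additive N →+ Γ) (α : Γ) : Set D :=
  {x | ∃ n : N, ((n : Dˣ) : D) = x ∧ φ (Additive.ofMul n) ≤ α}

/-- `α` is an s-level of `φ`: it is non-negative, `N_{> α}` is non-empty and
`1 ± N_{> α} ⊆ N_{≤ 0}`. -/
def IsSLevel (φ : Additive N →+ Γ) (α : Γ) : Prop :=
  0 ≤ α ∧ (levelGT φ α).Nonempty ∧
    ∀ x ∈ levelGT φ α, 1 + x ∈ levelLE φ 0 ∧ 1 - x ∈ levelLE φ 0

/-- Strongly leveled maps. -/
def IsStronglyLeveled (φ : Additive N →+ Γ) : Prop :=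
  ∃ α : Γ, IsSLevel φ α

/-- Strong valuation-like maps: strongly leveled maps to a totally ordered group. -/
def IsStrongValuationLike (φ : Additive N →+ Γ) : Prop :=
  (∀ a b : Γ, a ≤ b ∨ b ≤ a) ∧ IsStronglyLeveled φ

end Levels

section BaseField

variable (k : Type*) [Field k] {D : Type*} [DivisionRing D] [Algebra k D]

/-- The embedding `kˣ → Dˣ` of unit groups, for a `k`-algebra `D`. -/
def unitsMap : kˣ →* Dˣ :=
  Units.map (algebraMap k D : k →* D)

/-- `N ∩ kˣ`, as a subgroup of `kˣ`. -/
def interBase (N : Subgroup Dˣ) : Subgroup kˣ :=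
  N.comap (unitsMap k)

/-- The restriction of `φ : N → Γ` to `N ∩ kˣ`, with values in `Γ`. -/
def restrictBase {N : Subgroup Dˣ} {Γ : Type*} [AddGroup Γ] (φ : Additive N →+ Γ) :
    Additive (interBase k N) →+ Γ :=
  φ.comp (MonoidHom.toAdditive ((unitsMap k).subgroupComap N))

end BaseField

/-- There is a chain of `r` epimorphisms of totally ordered commutative groups
`Γ = Γ₀ → Γ₁ → ⋯ → Γᵣ = {1}`, each with a non-trivial kernel. -/
def HasHeightChain : ℕ → ∀ (Γ : Type u) [CommGroup Γ] [LinearOrder Γ], Prop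
  | 0, Γ, _, _ => Subsingleton Γ
  | r + 1, Γ, _, _ =>
    ∃ (Γ' : Type u) (_ : CommGroup Γ') (_ : LinearOrder Γ') (_ : IsOrderedMonoid Γ') (μ : Γ →* Γ'),
      Monotone μ ∧ Function.Surjective μ ∧ μ.ker ≠ ⊥ ∧ HasHeightChain r Γ'

/-- The height (rank) of a totally ordered commutative group: the supremum of the lengths of
such chains. -/
noncomputable def height (Γ : Type u) [CommGroup Γ] [LinearOrder Γ] : ℕ∞ :=
  ⨆ (r : ℕ) (_ : HasHeightChain r Γ), (r : ℕ∞)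

section Valuations

/-! Mathlib's valuations are written multiplicatively, with the reversed order: `v x ≥ 0` and
`v (x + y) ≥ min (v x) (v y)` in additive notation read `v x ≤ 1` and
`v (x + y) ≤ max (v x) (v y)`.  For a surjective valuation `v : Valuation k Γ₀` the
value group is `Γ₀ˣ`; reversing the order of a group does not affect its height. -/

variable {k : Type*} [Field k] {Γ₀ : Type*} [LinearOrderedCommGroupWithZero Γ₀]

/-- `v` is associated with `φ : N → Γ`: `φ n ≥ 0` implies `v n ≥ 0` (additively). -/
def IsAssociated (v : Valuation k Γ₀) {N : Subgroup kˣ} {Γ : Type*} [AddGroup Γ] [PartialOrder Γ]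
    (φ : Additive N →+ Γ) : Prop :=
  ∀ n : N, 0 ≤ φ (Additive.ofMul n) → v ((n : kˣ) : k) ≤ 1

/-- `S ⊆ kˣ` is open in the `v`-adic topology of `kˣ`, i.e. in the subspace topology coming from
the `v`-adic topology of `k`, in which the sets `{x | v x < γ}`, with `γ` in the value group, form a
basis of neighbourhoods of zero. -/
def IsAdicallyOpen (v : Valuation k Γ₀) (S : Set kˣ) : Prop :=
  @IsOpen kˣ (TopologicalSpace.induced (fun x : kˣ => (x : k)) v.subgroups_basis.topology) S

end Valuations

end LeveledMap

/-! Write `M` for `N ∩ kˣ`, `ψ` for the restriction of `φ` to `M`, and `e` for the index of `M`. The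
additive span of `N_{> α}` absorbs multiplication by elements of non-negative level, and `1` plus
this span stays in `N_{≤ 0}`; in particular the span omits `1`.

For (a), take `x ∈ N` above `α`. Its minimal polynomial writes `1` as a `k`-combination of positive
powers of `x`, all of which lie above `α`. Since `M` spans `k` additively
(`mem_addSubgroup_closure_unitsSubmonoid`), some `z ∈ M` clears the coefficients. Thus `z` lies in
the span, and `ψ z` is an s-level (`IsSLevel.exists_mem_levelSpan`).

For (b), `x ↦ ψ (x ^ e)` extends `e • ψ` to `kˣ`. The elements of large value under it span a group
`I` omitting `1`, and the multiplier ring of `I` is a proper valuation ring for which `M` is open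
(`IsSLevel.exists_valuationSubring`). Finite transcendence degree lets one coarsen it to height one
(`exists_le_isCoatom`); both association and openness survive coarsening. -/

namespace ValuationSubring

/-! ### Valuation rings and height one coarsenings -/

variable {k : Type*} [Field k]

theorem one_lt_valuation_iff (V : ValuationSubring k) (x : k) : 1 < V.valuation x ↔ x ∉ V := by
  rw [← not_le, V.valuation_le_one_iff]

/-- A polynomial over a subfield on which `V` is trivial takes at `x ∉ V` the value of its leading
monomial. -/
theorem valuation_aeval_eq_pow (V : ValuationSubring k) {E : Subfield k} (hE : ∀ y ∈ E, y ∈ V)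
    {x : k} (hx : x ∉ V) {p : Polynomial E} (hp : p ≠ 0) :
    V.valuation (Polynomial.aeval x p) = V.valuation x ^ p.natDegree := by
  have h1 : 1 < V.valuation x := (V.one_lt_valuation_iff x).2 hx
  have hlead : V.valuation ((p.leadingCoeff : E) : k) = 1 := by
    refine le_antisymm ((V.valuation_le_one_iff _).2 (hE _ p.leadingCoeff.2)) ?_
    have h := (V.valuation_le_one_iff _).2 (hE _ (p.leadingCoeff⁻¹).2)
    have hpos : 0 < V.valuation ((p.leadingCoeff : E) : k) := by
      rw [zero_lt_iff]; simpa using hp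
    rw [Subfield.coe_inv, map_inv₀] at h
    exact (inv_le_one₀ hpos).1 h
  rw [Polynomial.aeval_eq_sum_range, Finset.sum_range_succ]
  have hd : V.valuation (p.coeff p.natDegree • x ^ p.natDegree) = V.valuation x ^ p.natDegree := by
    rw [Polynomial.coeff_natDegree, Subfield.smul_def, smul_eq_mul, map_mul, hlead, one_mul,
      map_pow]
  rw [Valuation.map_add_eq_of_lt_right, hd]
  rw [hd]
  refine Valuation.map_sum_lt _ (pow_ne_zero _ (zero_lt_one.trans h1).ne') fun i hi => ?_
  rw [Subfield.smul_def, smul_eq_mul, map_mul, map_pow]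
  calc V.valuation (p.coeff i : k) * V.valuation x ^ i ≤ 1 * V.valuation x ^ i := by
        gcongr
        exact (V.valuation_le_one_iff _).2 (hE _ (p.coeff i).2)
    _ = V.valuation x ^ i := one_mul _
    _ < V.valuation x ^ p.natDegree := pow_lt_pow_right₀ h1 (Finset.mem_range.1 hi)

/-- Adjoining to a subfield of `V` an element `x` of an overring `W` outside of `V` gives a
subfield of `W`. -/
theorem closure_insert_le (V W : ValuationSubring k) (hVW : V ≤ W) {s : Set k}
    (hs : ∀ y ∈ Subfield.closure s, y ∈ V) {x : k} (hxV : x ∉ V) (hxW : x ∈ W) :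
    ∀ y ∈ Subfield.closure (insert x s), y ∈ W := by
  intro y hy
  have hle : Subfield.closure (insert x s) ≤
      (IntermediateField.adjoin (Subfield.closure s) {x}).toSubfield := by
    rw [Subfield.closure_le, Set.insert_subset_iff]
    refine ⟨IntermediateField.mem_adjoin_simple_self _ x, fun z hz => ?_⟩
    exact (IntermediateField.adjoin (Subfield.closure s) {x}).algebraMap_mem
      ⟨z, Subfield.subset_closure hz⟩
  obtain ⟨p, q, rfl⟩ := IntermediateField.mem_adjoin_simple_iff _ _ |>.1 (hle hy)
  have hmem (r : Polynomial (Subfield.closure s)) : Polynomial.aeval x r ∈ W := by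
    rw [Polynomial.aeval_eq_sum_range]
    refine sum_mem fun i _ => ?_
    rw [Subfield.smul_def, smul_eq_mul]
    exact MulMemClass.mul_mem (hVW (hs _ (r.coeff i).2)) (pow_mem hxW i)
  have hxinv : x⁻¹ ∈ W := hVW ((V.mem_or_inv_mem x).resolve_left hxV)
  rw [div_eq_mul_inv]
  refine MulMemClass.mul_mem (hmem p) ?_
  by_cases hq : q = 0
  · simp [hq]
  have h0 : V.valuation x ≠ 0 := by
    have := (V.one_lt_valuation_iff x).2 hxV
    exact (zero_lt_one.trans this).ne'
  -- The denominator has the value of `x ^ q.natDegree`, so it is this power times a unit of `V`;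
  -- the power is invertible in `W`.
  have hinv : (Polynomial.aeval x q)⁻¹ * x ^ q.natDegree ∈ V := by
    rw [← V.valuation_le_one_iff, map_mul, map_inv₀, V.valuation_aeval_eq_pow hs hxV hq, map_pow,
      inv_mul_cancel₀ (pow_ne_zero _ h0)]
  have hx0 : x ≠ 0 := by rintro rfl; exact hxV (zero_mem V)
  have := MulMemClass.mul_mem (hVW hinv) (pow_mem hxinv q.natDegree)
  rwa [mul_assoc, ← mul_pow, mul_inv_cancel₀ hx0, one_pow, mul_one] at this

/-- If a valuation ring does not contain the prime field, then some prime number is a non-zero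
non-unit in it. -/
theorem exists_prime_inv_notMem (V : ValuationSubring k) (hV : ¬ ∀ y ∈ (⊥ : Subfield k), y ∈ V) :
    ∃ p : ℕ, p.Prime ∧ ((p : k))⁻¹ ∉ V := by
  by_contra! h
  refine hV fun y hy => ?_
  have hnat (n : ℕ) : ((n : k))⁻¹ ∈ V := by
    induction n using Nat.recOnMul with
    | zero => simp
    | one => simp
    | prime p hp => exact h p hp
    | mul a b ha hb =>
      rw [Nat.cast_mul, mul_inv]
      exact MulMemClass.mul_mem ha hb
  rw [← Subfield.closure_empty, Subfield.mem_closure_iff] at hy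
  obtain ⟨a, ha, b, hb, rfl⟩ := hy
  rw [Subring.closure_empty, Subring.mem_bot] at ha hb
  obtain ⟨a, rfl⟩ := ha
  obtain ⟨b, rfl⟩ := hb
  rw [div_eq_mul_inv]
  refine MulMemClass.mul_mem (intCast_mem V a) ?_
  obtain ⟨n, rfl | rfl⟩ := b.eq_nat_or_neg
  · simpa using hnat n
  · simpa [inv_neg] using hnat n

theorem valuation_lt_one_of_inv_notMem (V : ValuationSubring k) {x : k} (hx : x⁻¹ ∉ V) :
    V.valuation x < 1 := by
  have h := (V.one_lt_valuation_iff _).2 hx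
  rw [map_inv₀] at h
  have h0 : V.valuation x ≠ 0 := by
    intro h0
    simp [h0] at h
  exact (one_lt_inv₀ (zero_lt_iff.2 h0)).1 h

/-- At most one prime number is a non-zero non-unit in a valuation ring. -/
theorem prime_eq_of_inv_notMem (V : ValuationSubring k) {p q : ℕ} (hp : p.Prime) (hq : q.Prime)
    (hpV : ((p : k))⁻¹ ∉ V) (hqV : ((q : k))⁻¹ ∉ V) : p = q := by
  by_contra hpq
  have hco : IsCoprime (p : ℤ) q := Nat.isCoprime_iff_coprime.2 ((Nat.coprime_primes hp hq).2 hpq)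
  obtain ⟨a, b, hab⟩ := hco
  have h : ((a : k)) * p + b * q = 1 := by exact_mod_cast congrArg (Int.cast : ℤ → k) hab
  have hlt (c : ℤ) {x : k} (hx : x⁻¹ ∉ V) : V.valuation (c * x) < 1 := by
    rw [map_mul]
    refine lt_of_le_of_lt ?_ (V.valuation_lt_one_of_inv_notMem hx)
    exact mul_le_of_le_one_left' ((V.valuation_le_one_iff _).2 (intCast_mem V c))
  have := V.valuation.map_add_lt (hlt a hpV) (hlt b hqV)
  rw [h, map_one] at this
  exact lt_irrefl _ this

/-- Among the overrings of a valuation ring that avoid an element there is a largest one. -/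
theorem exists_maximal_notMem (R : ValuationSubring k) {y : k} (hy : y ∉ R) :
    ∃ V : ValuationSubring k, R ≤ V ∧ y ∉ V ∧ ∀ W, V < W → y ∈ W := by
  -- Zorn can be applied to plain subrings: one that contains a valuation ring is a valuation ring.
  obtain ⟨S, hRS, hS⟩ := zorn_le_nonempty₀ {S : Subring k | y ∉ S} (fun c hc hchain T hT => by
    refine ⟨sSup c, ?_, fun S hS => le_sSup hS⟩
    rw [Set.mem_ofPred_eq, Subring.mem_sSup_of_directedOn ⟨T, hT⟩ hchain.directedOn]
    rintro ⟨S, hS, hyS⟩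
    exact hc hS hyS) R.toSubring hy
  refine ⟨ofLE R S hRS, hRS, hS.prop, fun W hW => ?_⟩
  by_contra hyW
  exact hW.not_ge (hS.le_of_ge (y := W.toSubring) hyW hW.le)

/-- In a field of finite transcendence degree over its prime field every non-trivial valuation has
a coarsening of height one. -/
theorem exists_le_isCoatom (hk : Algebra.trdeg (⊥ : Subfield k) k < Cardinal.aleph0)
    (R : ValuationSubring k) (hR : R ≠ ⊤) : ∃ V, R ≤ V ∧ IsCoatom V := by
  -- If no proper coarsening contains the prime field, a coarsening maximal without `p⁻¹` is a
  -- coatom: a larger ring contains `p⁻¹`, and no other prime can fail to be invertible there.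
  by_cases hA : ∀ V, R ≤ V → (∀ y ∈ (⊥ : Subfield k), y ∈ V) → V = ⊤
  · obtain ⟨p, hp, hpR⟩ := R.exists_prime_inv_notMem fun h => hR (hA R le_rfl h)
    obtain ⟨V, hRV, hpV, hV⟩ := R.exists_maximal_notMem hpR
    refine ⟨V, hRV, fun h => hpV (h ▸ mem_top _), fun W hVW => hA W (hRV.trans hVW.le) ?_⟩
    by_contra hW
    obtain ⟨q, hq, hqW⟩ := W.exists_prime_inv_notMem hW
    have := V.prime_eq_of_inv_notMem hp hq hpV fun h => hqW (hVW.le h)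
    exact hqW (this ▸ hV W hVW)
  · push Not at hA
    obtain ⟨V₀, hRV₀, hV₀, hV₀top⟩ := hA
    -- Choose a proper coarsening `V` containing a purely transcendental subfield of largest
    -- possible degree. A larger proper `W` has an element outside `V`, which is transcendental over
    -- that subfield and can be adjoined to it inside `W`.
    let P : ℕ → Prop := fun n => ∃ V, R ≤ V ∧ V ≠ ⊤ ∧ ∃ s : Finset k, s.card = n ∧
      AlgebraicIndepOn (⊥ : Subfield k) id (s : Set k) ∧
      ∀ y ∈ Subfield.closure (s : Set k), y ∈ V
    have hbound : ∀ n, P n → n ≤ Cardinal.toNat (Algebra.trdeg (⊥ : Subfield k) k) := by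
      rintro n ⟨V, -, -, s, rfl, hs, -⟩
      have h := AlgebraicIndependent.cardinalMk_le_trdeg hs
      have := Cardinal.toNat_le_toNat h hk
      simpa using this
    have hP0 : P 0 := by
      refine ⟨V₀, hRV₀, hV₀top, ∅, rfl, ?_, ?_⟩
      · rw [Finset.coe_empty]
        exact algebraicIndependent_empty
      · simpa using hV₀
    classical
    obtain ⟨n, hn, hmax⟩ : ∃ n, P n ∧ ∀ m, P m → m ≤ n :=
      ⟨_, Nat.findGreatest_spec (P := P) (Nat.zero_le _) hP0, fun m hm =>
        Nat.le_findGreatest (hbound m hm) hm⟩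
    obtain ⟨V, hRV, hVtop, s, rfl, hs, hsV⟩ := hn
    refine ⟨V, hRV, hVtop, fun W hVW => ?_⟩
    by_contra hW
    obtain ⟨x, hxW, hxV⟩ := SetLike.exists_of_lt hVW
    have hxs : x ∉ s := fun h => hxV (hsV x (Subfield.subset_closure h))
    have hlt := hmax (s.card + 1) ⟨W, hRV.trans hVW.le, hW, insert x s,
      Finset.card_insert_of_notMem hxs, ?_, ?_⟩
    · omega
    · rw [Finset.coe_insert]
      refine AlgebraicIndepOn.insert hs ?_
      rw [Set.image_id, id, transcendental_iff]
      intro p hp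
      by_contra hp0
      have hle : ∀ a : Algebra.adjoin (⊥ : Subfield k) (s : Set k),
          (a : k) ∈ Subfield.closure (s : Set k) := by
        rintro ⟨a, ha⟩
        induction ha using Algebra.adjoin_induction with
        | mem y hy => exact Subfield.subset_closure hy
        | algebraMap r => exact (bot_le : ⊥ ≤ Subfield.closure (s : Set k)) r.2
        | add _ _ _ _ h₁ h₂ => exact AddMemClass.add_mem h₁ h₂
        | mul _ _ _ _ h₁ h₂ => exact MulMemClass.mul_mem h₁ h₂
      let f : Algebra.adjoin (⊥ : Subfield k) (s : Set k) →+* Subfield.closure (s : Set k) :=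
        (algebraMap (Algebra.adjoin (⊥ : Subfield k) (s : Set k)) k).codRestrict
          (Subfield.closure (s : Set k)) hle
      have hf : Function.Injective f := fun a b h =>
        Subtype.ext (congrArg (Subtype.val : Subfield.closure (s : Set k) → k) h)
      have hq0 : p.map f ≠ 0 := (Polynomial.map_ne_zero_iff hf).2 hp0
      have h := V.valuation_aeval_eq_pow hsV hxV hq0
      have heq : Polynomial.aeval x (p.map f) = Polynomial.aeval x p := by
        rw [Polynomial.aeval_def, Polynomial.eval₂_map, Polynomial.aeval_def]
        rfl
      rw [heq, hp, map_zero] at h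
      have h1 := (V.one_lt_valuation_iff x).2 hxV
      exact pow_ne_zero _ (zero_lt_one.trans h1).ne' h.symm
    · rw [Finset.coe_insert]
      exact V.closure_insert_le W hVW.le hsV hxV hxW

/-- The value group of a maximal proper valuation ring is archimedean. -/
theorem exists_le_pow_of_isCoatom {V : ValuationSubring k} (hV : IsCoatom V)
    {a b : V.ValueGroup} (ha : 1 < a) : ∃ n : ℕ, b ≤ a ^ n := by
  -- The elements bounded by powers of `a` form an overring strictly larger than `V`, hence all of
  -- `k`.
  let S : Subring k :=
    { carrier := {x | ∃ n : ℕ, V.valuation x ≤ a ^ n}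
      mul_mem' := by
        rintro x y ⟨m, hm⟩ ⟨n, hn⟩
        refine ⟨m + n, ?_⟩
        rw [map_mul, pow_add]
        exact mul_le_mul' hm hn
      one_mem' := ⟨0, by simp⟩
      add_mem' := by
        rintro x y ⟨m, hm⟩ ⟨n, hn⟩
        refine ⟨max m n, V.valuation.map_add_le (hm.trans ?_) (hn.trans ?_)⟩
        · exact pow_le_pow_right₀ ha.le (le_max_left _ _)
        · exact pow_le_pow_right₀ ha.le (le_max_right _ _)
      zero_mem' := ⟨0, by simp⟩
      neg_mem' := by
        rintro x ⟨m, hm⟩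
        exact ⟨m, by rwa [Valuation.map_neg]⟩ }
  have hVS : V.toSubring ≤ S := fun x hx => ⟨0, by simpa using (V.valuation_le_one_iff x).2 hx⟩
  obtain ⟨x, rfl⟩ := V.valuation_surjective a
  obtain ⟨y, rfl⟩ := V.valuation_surjective b
  have hlt : V < ofLE V S hVS := by
    refine lt_of_le_of_ne hVS fun h => (V.one_lt_valuation_iff x).1 ha ?_
    rw [h]
    exact ⟨1, by simp⟩
  have htop := hV.2 _ hlt
  have hy : y ∈ ofLE V S hVS := htop ▸ mem_top y
  exact hy

end ValuationSubring

/-! ### Height one and openness -/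

namespace LeveledMap

/-- The powers of a kernel element `a > 1` bound both `b` and `b⁻¹`, which squeezes `μ b` to `1`. -/
theorem subsingleton_of_monotone_of_ker_ne_bot {Γ Γ' : Type*} [CommGroup Γ] [LinearOrder Γ]
    [IsOrderedMonoid Γ] [CommGroup Γ'] [LinearOrder Γ']
    (harch : ∀ a b : Γ, 1 < a → ∃ n : ℕ, b ≤ a ^ n) {μ : Γ →* Γ'}
    (hmono : Monotone μ) (hsurj : Function.Surjective μ) (hker : μ.ker ≠ ⊥) :
    Subsingleton Γ' := by
  obtain ⟨a, ha, ha1⟩ : ∃ a : Γ, μ a = 1 ∧ 1 < a := by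
    obtain ⟨⟨a, ha⟩, hne⟩ := Subgroup.ne_bot_iff_exists_ne_one.1 hker
    replace hne : a ≠ 1 := fun h => hne (Subtype.ext h)
    replace ha : μ a = 1 := ha
    rcases lt_or_gt_of_ne hne with h | h
    · exact ⟨a⁻¹, by rw [map_inv, ha, inv_one], one_lt_inv'.2 h⟩
    · exact ⟨a, ha, h⟩
  have hle (b : Γ) : μ b ≤ 1 := by
    obtain ⟨n, hn⟩ := harch a b ha1
    simpa [ha] using hmono hn
  have hone (b : Γ) : μ b = 1 := by
    have hinv := harch a b⁻¹ ha1
    obtain ⟨n, hn⟩ := hinv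
    have hn' : (a ^ n)⁻¹ ≤ b := inv_le_of_inv_le' hn
    refine le_antisymm (hle b) ?_
    simpa [ha] using hmono hn'
  refine ⟨fun x y => ?_⟩
  obtain ⟨b, rfl⟩ := hsurj x
  obtain ⟨c, rfl⟩ := hsurj y
  rw [hone, hone]

theorem height_eq_one {Γ : Type u} [CommGroup Γ] [LinearOrder Γ] [IsOrderedMonoid Γ]
    [Nontrivial Γ] (harch : ∀ a b : Γ, 1 < a → ∃ n : ℕ, b ≤ a ^ n) : height Γ = 1 := by
  refine le_antisymm (iSup₂_le fun r hr => ?_) ?_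
  · match r, hr with
    | 0, _ => simp
    | 1, _ => simp
    | r + 2, ⟨Γ', _, _, _, μ, hmono, hsurj, hker, Γ'', _, _, _, ν, _, _, hker', _⟩ =>
      have := subsingleton_of_monotone_of_ker_ne_bot harch hmono hsurj hker
      exact absurd (Subsingleton.elim _ _) hker'
  · refine le_iSup₂_of_le (f := fun r (_ : HasHeightChain r Γ) => (r : ℕ∞)) 1 ?_ (by simp)
    refine ⟨PUnit, inferInstance, inferInstance, ⟨fun _ _ _ _ => le_rfl, fun _ _ _ _ => le_rfl⟩, 1,
      fun _ _ _ => le_rfl, fun _ => ⟨1, rfl⟩, ?_, ?_⟩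
    · simp
    · exact inferInstanceAs (Subsingleton PUnit)

/-- A set of units that contains the translate by each of its elements of a small enough
neighbourhood of zero is open. -/
theorem isAdicallyOpen_subgroup {k : Type*} [Field k] (V : ValuationSubring k) (M : Subgroup kˣ)
    {c : k} (hc : c ≠ 0)
    (h : ∀ x : kˣ, V.valuation ((x : k) - 1) < V.valuation c → x ∈ M) :
    IsAdicallyOpen V.valuation (M : Set kˣ) := by
  let hv : Valued k V.ValueGroup := Valued.mk' V.valuation
  have hinst : (V.valuation.subgroups_basis.topology) = hv.toTopologicalSpace := rfl
  unfold IsAdicallyOpen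
  rw [hinst]
  rw [@isOpen_iff_mem_nhds]
  intro x hx
  rw [nhds_induced, Filter.mem_comap]
  have hxc : (x : k) * c ≠ 0 := mul_ne_zero x.ne_zero hc
  have hγ : V.valuation.restrict ((x : k) * c) ≠ 0 := by
    rwa [Ne, map_eq_zero]
  refine ⟨{y | V.valuation.restrict (y - x) < V.valuation.restrict ((x : k) * c)}, ?_, ?_⟩
  · rw [Valued.mem_nhds]
    exact ⟨Units.mk0 _ hγ, fun y hy => hy⟩
  · intro y hy
    have hy' : V.valuation ((y : k) - x) < V.valuation ((x : k) * c) := by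
      exact (Valuation.restrict_lt_iff _).1 hy
    have hq : x⁻¹ * y ∈ M := by
      refine h _ ?_
      have h1 : ((x⁻¹ * y : kˣ) : k) - 1 = (x : k)⁻¹ * (y - x) := by
        rw [Units.val_mul, mul_sub, Units.val_inv_eq_inv_val, inv_mul_cancel₀ x.ne_zero]
      have hpos : 0 < V.valuation (x : k) := by rw [zero_lt_iff]; simp
      rw [h1, map_mul, map_inv₀, inv_mul_lt_iff₀ hpos, ← map_mul]
      exact hy'
    simpa using mul_mem hx hq

/-! ### Additive span of a subgroup of finite index -/

section Span

/-- The elements of a subgroup of `kˣ`, as a submonoid of `k`. -/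
def unitsSubmonoid {k : Type*} [Field k] (M : Subgroup kˣ) : Submonoid k :=
  M.toSubmonoid.map (Units.coeHom k)

/-- A subgroup of finite index of the multiplicative group of an infinite field spans the field
additively. -/
theorem mem_addSubgroup_closure_unitsSubmonoid {k : Type*} [Field k] [Infinite k] (M : Subgroup kˣ)
    [M.FiniteIndex] (x : k) : x ∈ AddSubgroup.closure (unitsSubmonoid M : Set k) := by
  suffices h : x ∈ Subring.closure (unitsSubmonoid M : Set k) by
    rwa [Subring.mem_closure_iff, Submonoid.closure_eq] at h
  set S := Subring.closure (unitsSubmonoid M : Set k)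
  have hMS {m : kˣ} (hm : m ∈ M) : (m : k) ∈ S := Subring.subset_closure ⟨m, hm, rfl⟩
  -- `S` is a subfield: with `e` the index, `s⁻¹ = s ^ (e - 1) * (s ^ e)⁻¹` and `s ^ e ∈ M`.
  have hinv {s : k} (hs : s ∈ S) (hs0 : s ≠ 0) : s⁻¹ ∈ S := by
    have hpow : (Units.mk0 s hs0) ^ M.index ∈ M := M.pow_index_mem _
    have h := mul_mem (pow_mem hs (M.index - 1)) (hMS (inv_mem hpow))
    have hidx : M.index - 1 + 1 = M.index := Nat.sub_add_cancel
      (Nat.one_le_iff_ne_zero.2 Subgroup.FiniteIndex.index_ne_zero)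
    have heq : s ^ (M.index - 1) * (((Units.mk0 s hs0) ^ M.index)⁻¹ : kˣ) = s⁻¹ := by
      rw [Units.val_inv_eq_inv_val, Units.val_pow_eq_pow_val, Units.val_mk0]
      rw [← hidx, Nat.add_sub_cancel, pow_succ]
      field_simp
    rwa [heq] at h
  by_contra hx
  have hne (s : k) (hs : s ∈ S) : x + s ≠ 0 := fun h => hx (by
    rw [eq_neg_of_add_eq_zero_left h]
    exact neg_mem hs)
  have hinf : Infinite M := by
    by_contra hfin
    rw [not_infinite_iff_finite] at hfin
    have : Finite kˣ := (finite_iff_subgroup_quotient M).2 ⟨hfin, inferInstance⟩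
    have : Finite k := Finite.of_surjective (fun o : Option kˣ => o.elim 0 fun u => (u : k))
      fun y => (eq_or_ne y 0).elim (fun h => ⟨none, h.symm⟩) fun h => ⟨some (Units.mk0 y h), rfl⟩
    exact not_finite k
  -- Two of the infinitely many `x + m` share a coset of `M`; their quotient `u ∈ M` gives a linear
  -- equation for `x` over `S`.
  obtain ⟨a, b, hab, h⟩ := Finite.exists_ne_map_eq_of_infinite fun m : M =>
    (QuotientGroup.mk (Units.mk0 (x + ((m : kˣ) : k)) (hne _ (hMS m.2))) : kˣ ⧸ M)
  rw [QuotientGroup.eq] at h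
  set u := (Units.mk0 (x + ((a : kˣ) : k)) (hne _ (hMS a.2)))⁻¹ *
    Units.mk0 (x + ((b : kˣ) : k)) (hne _ (hMS b.2))
  have hu : (x + ((a : kˣ) : k)) * (u : k) = x + ((b : kˣ) : k) := by
    have := hne _ (hMS a.2)
    simp only [u, Units.val_mul, Units.val_inv_eq_inv_val, Units.val_mk0]
    field_simp
  have hu1 : (1 : k) - u ≠ 0 := by
    intro h1
    rw [← sub_eq_zero.1 h1, mul_one] at hu
    exact hab (Subtype.ext (Units.ext (add_left_cancel hu)))
  have hxeq : x = (((a : kˣ) : k) * u - ((b : kˣ) : k)) * ((1 : k) - u)⁻¹ := by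
    field_simp
    linear_combination -hu
  apply hx
  rw [hxeq]
  exact mul_mem (sub_mem (mul_mem (hMS a.2) (hMS h)) (hMS b.2))
    (hinv (sub_mem (one_mem S) (hMS h)) hu1)

end Span

/-! ### The additive span of a level set -/

section LevelIdeal

variable {D : Type*} [DivisionRing D] {N : Subgroup Dˣ} {Γ : Type*} [AddGroup Γ] [PartialOrder Γ]
  {φ : Additive N →+ Γ} {α : Γ}

theorem mem_levelGT (n : N) : ((n : Dˣ) : D) ∈ levelGT φ α ↔ α < φ (Additive.ofMul n) := by
  refine ⟨?_, fun h => ⟨n, rfl, h⟩⟩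
  rintro ⟨m, hm, h⟩
  rwa [Subtype.ext (Units.ext hm) (a1 := m) (a2 := n)] at h

theorem zero_notMem_levelLE : (0 : D) ∉ levelLE φ α := by
  rintro ⟨n, hn, -⟩
  exact (n : Dˣ).ne_zero hn

/-- The additive subgroup spanned by the elements of level greater than `α`. -/
def levelSpan (φ : Additive N →+ Γ) (α : Γ) : AddSubgroup D :=
  AddSubgroup.closure (levelGT φ α)

theorem mul_mem_levelSpan [AddRightMono Γ] {y : D} (hy : y ∈ levelSpan φ α) {n : N}
    (hn : 0 ≤ φ (Additive.ofMul n)) : ((n : Dˣ) : D) * y ∈ levelSpan φ α := by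
  induction hy using AddSubgroup.closure_induction with
  | mem y hy =>
    obtain ⟨m, rfl, hm⟩ := hy
    refine AddSubgroup.subset_closure ⟨n * m, by simp, ?_⟩
    rw [ofMul_mul, map_add]
    exact hm.trans_le (le_add_of_nonneg_left hn)
  | zero => simp
  | add y z _ _ hy hz => rw [mul_add]; exact add_mem hy hz
  | neg y _ hy => rw [mul_neg]; exact neg_mem hy

variable [AddLeftMono Γ] [AddRightMono Γ]

/-- For a generator `n`, factor `u ± n = u * (1 ± u⁻¹ * n)`: as `u⁻¹` has non-negative level, `u⁻¹ *
n` is still above `α`. Letting `u` vary allows generators to be added one by one. -/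
theorem IsSLevel.add_mem_levelLE (hα : IsSLevel φ α) {y : D} (hy : y ∈ levelSpan φ α) :
    ∀ u ∈ levelLE φ 0, u + y ∈ levelLE φ 0 := by
  have key (y : D) (hy : y ∈ levelSpan φ α) :
      (∀ u ∈ levelLE φ 0, u + y ∈ levelLE φ 0) ∧ ∀ u ∈ levelLE φ 0, u + -y ∈ levelLE φ 0 := by
    induction hy using AddSubgroup.closure_induction with
    | mem y hy =>
      have hquot {u : N} (hu : φ (Additive.ofMul u) ≤ 0) {n : N} (hn : α < φ (Additive.ofMul n)) :
          (((u⁻¹ * n : N) : Dˣ) : D) ∈ levelGT φ α := by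
        rw [mem_levelGT, ofMul_mul, ofMul_inv, map_add, map_neg]
        exact hn.trans_le (le_add_of_nonneg_left (neg_nonneg.2 hu))
      have hprod {u : N} (hu : φ (Additive.ofMul u) ≤ 0) {y : D} (hy : y ∈ levelLE φ 0) :
          ((u : Dˣ) : D) * y ∈ levelLE φ 0 := by
        obtain ⟨n, rfl, hn⟩ := hy
        refine ⟨u * n, by simp, ?_⟩
        rw [ofMul_mul, map_add]
        exact add_nonpos hu hn
      obtain ⟨n, rfl, hn⟩ := hy
      constructor
      · rintro _ ⟨u, rfl, hu⟩
        have := hprod hu (hα.2.2 _ (hquot hu hn)).1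
        simpa [mul_add] using this
      · rintro _ ⟨u, rfl, hu⟩
        have := hprod hu (hα.2.2 _ (hquot hu hn)).2
        simpa [mul_sub, ← sub_eq_add_neg] using this
    | zero => simp
    | add y z _ _ hy hz =>
      refine ⟨fun u hu => ?_, fun u hu => ?_⟩
      · rw [← add_assoc]
        exact hz.1 _ (hy.1 u hu)
      · rw [neg_add_rev, ← add_assoc]
        exact hy.2 _ (hz.2 u hu)
    | neg y _ hy => exact ⟨hy.2, by simpa using hy.1⟩
  exact (key y hy).1

theorem IsSLevel.one_add_mem_levelLE (hα : IsSLevel φ α) {y : D} (hy : y ∈ levelSpan φ α) :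
    1 + y ∈ levelLE φ 0 :=
  hα.add_mem_levelLE hy 1 ⟨1, rfl, by simp⟩

theorem IsSLevel.one_notMem_levelSpan (hα : IsSLevel φ α) : (1 : D) ∉ levelSpan φ α := fun h =>
  zero_notMem_levelLE (φ := φ) (α := 0) (by simpa using hα.one_add_mem_levelLE (neg_mem h))

theorem pow_mem_levelGT (hα : 0 ≤ α) {n : N} (hn : α < φ (Additive.ofMul n)) (i : ℕ) :
    (((n : Dˣ) : D)) ^ (i + 1) ∈ levelGT φ α := by
  refine ⟨n ^ (i + 1), by simp, ?_⟩
  rw [ofMul_pow, map_nsmul, succ_nsmul]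
  exact hn.trans_le (le_add_of_nonneg_left (nsmul_nonneg (hα.trans hn.le) i))

end LevelIdeal

section BaseChange

variable {k : Type*} [Field k] {D : Type*} [DivisionRing D] [Algebra k D] {N : Subgroup Dˣ}
  {Γ : Type*} [AddGroup Γ] {φ : Additive N →+ Γ}

/-- The element of `N` given by an element of `N ∩ kˣ`. -/
def toN (m : interBase k N) : N := (unitsMap k).subgroupComap N m

theorem coe_toN (m : interBase k N) : ((toN m : Dˣ) : D) = algebraMap k D ((m : kˣ) : k) := rfl

theorem restrictBase_apply (m : interBase k N) :
    restrictBase k φ (Additive.ofMul m) = φ (Additive.ofMul (toN m)) := rfl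

end BaseChange

/-! ### Restriction to the base field: part (a) -/

section Restriction

variable {k : Type*} [Field k] {M : Subgroup kˣ} {Γ : Type*} [AddGroup Γ] [PartialOrder Γ]
  {ψ : Additive M →+ Γ}

/-- The additive span of the elements of non-negative level. -/
def nonnegSpan (ψ : Additive M →+ Γ) : AddSubgroup k :=
  AddSubgroup.closure {x | ∃ m : M, ((m : kˣ) : k) = x ∧ 0 ≤ ψ (Additive.ofMul m)}

theorem mul_mem_nonnegSpan [AddLeftMono Γ] {y : k} (hy : y ∈ nonnegSpan ψ) {n : M}
    (hn : 0 ≤ ψ (Additive.ofMul n)) : ((n : kˣ) : k) * y ∈ nonnegSpan ψ := by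
  induction hy using AddSubgroup.closure_induction with
  | mem y hy =>
    obtain ⟨m, rfl, hm⟩ := hy
    refine AddSubgroup.subset_closure ⟨n * m, by simp, ?_⟩
    rw [ofMul_mul, map_add]
    exact add_nonneg hn hm
  | zero => simp
  | add y z _ _ hy hz => rw [mul_add]; exact add_mem hy hz
  | neg y _ hy => rw [mul_neg]; exact neg_mem hy

variable {D : Type*} [DivisionRing D] [Algebra k D]
  {N : Subgroup Dˣ} {φ : Additive N →+ Γ} {α : Γ}

theorem smul_mem_levelSpan [AddRightMono Γ] {y : D} (hy : y ∈ levelSpan φ α) {c : k}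
    (hc : c ∈ nonnegSpan (restrictBase k φ)) : c • y ∈ levelSpan φ α := by
  induction hc using AddSubgroup.closure_induction with
  | mem c hc =>
    obtain ⟨m, rfl, hm⟩ := hc
    rw [Algebra.smul_def, ← coe_toN]
    exact mul_mem_levelSpan hy hm
  | zero => simp
  | add c d _ _ hc hd => rw [add_smul]; exact add_mem hc hd
  | neg c _ hc => rw [neg_smul]; exact neg_mem hc

variable [AddLeftMono Γ]

/-- A summand `m ∈ M` of `c` is cleared by `1` or by `m⁻¹`, according to the sign of `ψ m`;
multipliers of several summands are multiplied together. -/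
theorem exists_mul_mem_nonnegSpan [Infinite k] [M.FiniteIndex]
    (htot : ∀ a ∈ ψ.range, ∀ b ∈ ψ.range, a ≤ b ∨ b ≤ a) (c : k) :
    ∃ z : M, 0 ≤ ψ (Additive.ofMul z) ∧ ((z : kˣ) : k) * c ∈ nonnegSpan ψ := by
  have hc := mem_addSubgroup_closure_unitsSubmonoid M c
  induction hc using AddSubgroup.closure_induction with
  | mem c hc =>
    obtain ⟨m, hm, rfl⟩ := hc
    rcases htot 0 (zero_mem _) (ψ (Additive.ofMul ⟨m, hm⟩)) ⟨_, rfl⟩ with h | h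
    · refine ⟨1, by simp, ?_⟩
      rw [OneMemClass.coe_one, Units.val_one, one_mul]
      exact AddSubgroup.subset_closure ⟨⟨m, hm⟩, rfl, h⟩
    · refine ⟨⟨m, hm⟩⁻¹, ?_, ?_⟩
      · rw [ofMul_inv, map_neg]
        exact neg_nonneg.2 h
      · exact AddSubgroup.subset_closure ⟨1, by simp, by simp⟩
  | zero => exact ⟨1, by simp, by simp⟩
  | add c d _ _ hc hd =>
    obtain ⟨y, hy, hyc⟩ := hc
    obtain ⟨z, hz, hzd⟩ := hd
    refine ⟨y * z, by rw [ofMul_mul, map_add]; exact add_nonneg hy hz, ?_⟩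
    have h := add_mem (mul_mem_nonnegSpan hyc hz) (mul_mem_nonnegSpan hzd hy)
    convert h using 1
    push_cast
    ring
  | neg c _ hc =>
    obtain ⟨z, hz, hzc⟩ := hc
    exact ⟨z, hz, by rw [mul_neg]; exact neg_mem hzc⟩

theorem exists_forall_mul_mem_nonnegSpan [Infinite k] [M.FiniteIndex]
    (htot : ∀ a ∈ ψ.range, ∀ b ∈ ψ.range, a ≤ b ∨ b ≤ a) (s : Finset k) :
    ∃ z : M, 0 ≤ ψ (Additive.ofMul z) ∧ ∀ c ∈ s, ((z : kˣ) : k) * c ∈ nonnegSpan ψ := by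
  classical
  induction s using Finset.induction_on with
  | empty => exact ⟨1, by simp, by simp⟩
  | insert c s _ ih =>
    obtain ⟨y, hy, hys⟩ := ih
    obtain ⟨z, hz, hzc⟩ := exists_mul_mem_nonnegSpan htot c
    refine ⟨y * z, by rw [ofMul_mul, map_add]; exact add_nonneg hy hz, fun d hd => ?_⟩
    rcases Finset.mem_insert.1 hd with rfl | hd
    · simpa [mul_assoc] using mul_mem_nonnegSpan hzc hy
    · simpa [mul_assoc, mul_left_comm] using mul_mem_nonnegSpan (hys d hd) hz

variable [AddRightMono Γ]

/-- The span of the elements of large level meets the base field in an element of `N`. -/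
theorem IsSLevel.exists_mem_levelSpan [Infinite k] [FiniteDimensional k D]
    [(interBase k N).FiniteIndex]
    (htot : ∀ a ∈ (restrictBase k φ).range, ∀ b ∈ (restrictBase k φ).range, a ≤ b ∨ b ≤ a)
    (hα : IsSLevel φ α) : ∃ z : interBase k N, 0 < restrictBase k φ (Additive.ofMul z) ∧
      ((toN z : Dˣ) : D) ∈ levelSpan φ α := by
  classical
  obtain ⟨hα0, ⟨x, n, rfl, hn⟩, -⟩ := id hα
  set x : D := ((n : Dˣ) : D)
  have hint : IsIntegral k x := Algebra.IsIntegral.isIntegral x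
  have hx0 : x ≠ 0 := (n : Dˣ).ne_zero
  set p := minpoly k x with hp
  have hp0 : p.coeff 0 ≠ 0 := minpoly.coeff_zero_ne_zero hint hx0
  obtain ⟨z, hz, hzc⟩ := exists_forall_mul_mem_nonnegSpan htot
    -- These are the coefficients of `1` as a combination of `x, x ^ 2, …`, read off from the
    -- minimal polynomial.
    ((Finset.range p.natDegree).image fun i => -(p.coeff 0)⁻¹ * p.coeff (i + 1))
  have hmem : ((toN z : Dˣ) : D) ∈ levelSpan φ α := by
    have hsum : p.coeff 0 • (1 : D) =
        -∑ i ∈ Finset.range p.natDegree, p.coeff (i + 1) • x ^ (i + 1) := by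
      have h := minpoly.aeval k x
      rw [Polynomial.aeval_eq_sum_range, Finset.sum_range_succ', ← hp, pow_zero] at h
      exact eq_neg_of_add_eq_zero_right h
    have hzsum : ((toN z : Dˣ) : D) = ∑ i ∈ Finset.range p.natDegree,
        (((z : kˣ) : k) * (-(p.coeff 0)⁻¹ * p.coeff (i + 1))) • x ^ (i + 1) := by
      have h1 : ((toN z : Dˣ) : D) = (((z : kˣ) : k) * (p.coeff 0)⁻¹) • (p.coeff 0 • (1 : D)) := by
        rw [smul_smul, mul_assoc, inv_mul_cancel₀ hp0, mul_one, coe_toN,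
          Algebra.algebraMap_eq_smul_one]
      rw [h1, hsum, smul_neg, Finset.smul_sum, ← Finset.sum_neg_distrib]
      refine Finset.sum_congr rfl fun i _ => ?_
      rw [smul_smul, ← neg_smul]
      congr 1
      ring
    rw [hzsum]
    refine sum_mem fun i hi => smul_mem_levelSpan ?_ (hzc _ (Finset.mem_image_of_mem _ hi))
    exact AddSubgroup.subset_closure (pow_mem_levelGT hα0 hn i)
  -- At level `0`, multiplication by `z⁻¹` would put `1` into the span.
  refine ⟨z, lt_of_le_of_ne hz fun h => hα.one_notMem_levelSpan ?_, hmem⟩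
  have hinv : 0 ≤ φ (Additive.ofMul (toN z)⁻¹) := by
    rw [ofMul_inv, map_neg, ← restrictBase_apply, ← h, neg_zero]
  simpa using mul_mem_levelSpan hmem hinv

/-- The level of `z` works: an `m` above it is `(m * z⁻¹) * z`, hence lies in the span. -/
theorem IsSLevel.exists_isSLevel_restrictBase [Infinite k] [FiniteDimensional k D]
    [(interBase k N).FiniteIndex]
    (htot : ∀ a ∈ (restrictBase k φ).range, ∀ b ∈ (restrictBase k φ).range, a ≤ b ∨ b ≤ a)
    (hα : IsSLevel φ α) : ∃ β, IsSLevel (restrictBase k φ).rangeRestrict β := by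
  obtain ⟨z, hz, hzmem⟩ := hα.exists_mem_levelSpan htot
  have hmem {m : interBase k N} (hm : restrictBase k φ (Additive.ofMul z) <
      restrictBase k φ (Additive.ofMul m)) : ((toN m : Dˣ) : D) ∈ levelSpan φ α := by
    have hq : 0 ≤ φ (Additive.ofMul (toN (m * z⁻¹))) := by
      rw [← restrictBase_apply, ofMul_mul, ofMul_inv, map_add, map_neg, ← sub_eq_add_neg]
      exact sub_nonneg.2 hm.le
    have h := mul_mem_levelSpan hzmem hq
    rw [coe_toN, coe_toN, ← map_mul] at h
    simpa [coe_toN] using h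
  have hlevel {x : k} (hx : 1 + algebraMap k D x ∈ levelLE φ 0) :
      1 + x ∈ levelLE (restrictBase k φ).rangeRestrict 0 := by
    obtain ⟨n, hn, hn0⟩ := hx
    rw [← map_one (algebraMap k D), ← map_add] at hn
    have h0 : 1 + x ≠ 0 := fun h => by
      rw [h, map_zero] at hn
      exact (n : Dˣ).ne_zero hn
    have hval : unitsMap k (D := D) (Units.mk0 (1 + x) h0) = n := Units.ext hn.symm
    have hmemN : Units.mk0 (1 + x) h0 ∈ interBase k N := by
      change unitsMap k (D := D) (Units.mk0 (1 + x) h0) ∈ N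
      rw [hval]
      exact n.2
    refine ⟨⟨_, hmemN⟩, rfl, ?_⟩
    change restrictBase k φ _ ≤ 0
    rw [restrictBase_apply]
    convert hn0
    exact Subtype.ext hval
  refine ⟨(restrictBase k φ).rangeRestrict (Additive.ofMul z), hz.le, ?_, ?_⟩
  · refine ⟨_, z * z, rfl, ?_⟩
    rw [ofMul_mul, map_add]
    change restrictBase k φ _ < restrictBase k φ _ + restrictBase k φ _
    exact lt_add_of_pos_left _ hz
  · rintro _ ⟨m, rfl, hm⟩
    refine ⟨hlevel (hα.one_add_mem_levelLE (hmem hm)), ?_⟩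
    rw [sub_eq_add_neg]
    refine hlevel ?_
    rw [map_neg]
    exact hα.one_add_mem_levelLE (neg_mem (hmem hm))

end Restriction

/-! ### From a strong valuation-like map to a valuation ring -/

section ValuationRing

variable {k : Type*} [Field k] {M : Subgroup kˣ} {Δ : Type*} [AddCommGroup Δ]
  {ψ : Additive M →+ Δ}

/-- The homomorphism `x ↦ ψ (x ^ e)`, with `e` the index of `M`. -/
noncomputable def powIndex (ψ : Additive M →+ Δ) : Additive kˣ →+ Δ :=
  ψ.comp (MonoidHom.toAdditive ((powMonoidHom M.index).codRestrict M fun x => M.pow_index_mem x))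

theorem powIndex_coe (m : M) :
    powIndex ψ (Additive.ofMul (m : kˣ)) = M.index • ψ (Additive.ofMul m) := by
  rw [← map_nsmul, ← ofMul_pow]
  rfl

variable [M.FiniteIndex] [LinearOrder Δ] [IsOrderedAddMonoid Δ] {α : Δ}

theorem exists_forall_mul_mem_levelSpan [Infinite k] (c : k) :
    ∃ B : Δ, ∀ m : M, B < ψ (Additive.ofMul m) → c * ((m : kˣ) : k) ∈ levelSpan ψ α := by
  have hc := mem_addSubgroup_closure_unitsSubmonoid M c
  induction hc using AddSubgroup.closure_induction with
  | mem c hc =>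
    obtain ⟨n, hn, rfl⟩ := hc
    refine ⟨α - ψ (Additive.ofMul ⟨n, hn⟩), fun m hm => ?_⟩
    refine AddSubgroup.subset_closure ⟨⟨n, hn⟩ * m, by simp, ?_⟩
    rw [ofMul_mul, map_add]
    exact sub_lt_iff_lt_add'.1 hm
  | zero => exact ⟨0, by simp⟩
  | add c d _ _ hc hd =>
    obtain ⟨B, hB⟩ := hc
    obtain ⟨C, hC⟩ := hd
    refine ⟨max B C, fun m hm => ?_⟩
    rw [add_mul]
    exact add_mem (hB m ((le_max_left _ _).trans_lt hm)) (hC m ((le_max_right _ _).trans_lt hm))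
  | neg c _ hc =>
    obtain ⟨B, hB⟩ := hc
    refine ⟨B, fun m hm => ?_⟩
    rw [neg_mul]
    exact neg_mem (hB m hm)

/-- Write `x` as a coset representative times some `m ∈ M`. There are finitely many representatives,
so a large value of `x` forces `ψ m` beyond the bound `B` of its representative. -/
theorem exists_forall_mem_levelSpan [Infinite k] (ψ : Additive M →+ Δ) (α : Δ) :
    ∃ C : Δ, ∀ x : kˣ, C < powIndex ψ (Additive.ofMul x) → (x : k) ∈ levelSpan ψ α := by
  choose B hB using fun q : kˣ ⧸ M =>
    exists_forall_mul_mem_levelSpan (ψ := ψ) (α := α) ((q.out : kˣ) : k)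
  obtain ⟨C, hC⟩ := (Set.finite_range fun q : kˣ ⧸ M =>
    powIndex ψ (Additive.ofMul q.out) + M.index • B q).bddAbove
  refine ⟨C, fun x hx => ?_⟩
  obtain ⟨m, hm⟩ := QuotientGroup.mk_out_eq_mul M x
  have hxm : x = (QuotientGroup.mk x : kˣ ⧸ M).out * (m⁻¹ : M) := by
    rw [hm]
    simp
  have hlt := (hC ⟨QuotientGroup.mk x, rfl⟩).trans_lt hx
  have hpow : powIndex ψ (Additive.ofMul x) =
      powIndex ψ (Additive.ofMul (QuotientGroup.mk x : kˣ ⧸ M).out) +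
        M.index • ψ (Additive.ofMul m⁻¹) := by
    conv_lhs => rw [hxm]
    rw [ofMul_mul, map_add, powIndex_coe]
  dsimp only at hlt
  rw [hpow] at hlt
  have h := hB _ m⁻¹ (lt_of_nsmul_lt_nsmul_right M.index (lt_of_add_lt_add_left hlt))
  rwa [← Units.val_mul, ← hxm] at h

/-- A strong valuation-like map on a subgroup `M` of finite index of `kˣ` gives a non-trivial
valuation ring of `k` for which `M` is open. -/
theorem IsSLevel.exists_valuationSubring [Infinite k] (hα : IsSLevel ψ α)
    (hsurj : Function.Surjective ψ) :
    ∃ (R : ValuationSubring k) (t : k), t ≠ 0 ∧ R ≠ ⊤ ∧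
      (∀ m : M, 0 ≤ ψ (Additive.ofMul m) → ((m : kˣ) : k) ∈ R) ∧
      ∀ r ∈ R, ∀ x : kˣ, (x : k) = 1 + r * t → x ∈ M := by
  obtain ⟨C, hC⟩ := exists_forall_mem_levelSpan ψ α
  set W := powIndex ψ with hW
  have hidx : M.index ≠ 0 := Subgroup.FiniteIndex.index_ne_zero
  obtain ⟨t, ht⟩ : ∃ t : kˣ, C < W (Additive.ofMul t) := by
    obtain ⟨-, ⟨-, n, -, hn⟩, -⟩ := id hα
    -- The maximum with `0` ensures that multiplying by the index does not decrease the value.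
    obtain ⟨m, hm⟩ := hsurj (max C 0)
    refine ⟨((m.toMul * n : M) : kˣ), ?_⟩
    have h0 : 0 < ψ (Additive.ofMul n) := hα.1.trans_lt hn
    have h1 : max C 0 < ψ (Additive.ofMul (m.toMul * n)) := by
      rw [ofMul_mul, map_add, ofMul_toMul, hm]
      exact lt_add_of_pos_right _ h0
    rw [hW, powIndex_coe]
    calc C ≤ max C 0 := le_max_left _ _
      _ < ψ (Additive.ofMul (m.toMul * n)) := h1
      _ ≤ _ := le_self_nsmul ((le_max_right _ _).trans h1.le) hidx
  let I : AddSubgroup k := AddSubgroup.closure {x | ∃ u : kˣ, (u : k) = x ∧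
    C < W (Additive.ofMul u)}
  have hI : I ≤ levelSpan ψ α := by
    rw [AddSubgroup.closure_le]
    rintro _ ⟨u, rfl, hu⟩
    exact hC u hu
  -- The multiplier ring of `I`. It contains every unit of non-negative `W`-value, hence `x` or
  -- `x⁻¹` for each `x`.
  let S : Subring k :=
    { carrier := {r | ∀ y ∈ I, r * y ∈ I}
      mul_mem' := fun {a b} ha hb y hy => by rw [mul_assoc]; exact ha _ (hb _ hy)
      one_mem' := fun y hy => by rwa [one_mul]
      add_mem' := fun {a b} ha hb y hy => by rw [add_mul]; exact add_mem (ha _ hy) (hb _ hy)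
      zero_mem' := fun y hy => by rw [zero_mul]; exact zero_mem I
      neg_mem' := fun {a} ha y hy => by rw [neg_mul]; exact neg_mem (ha _ hy) }
  have hS (u : kˣ) (hu : 0 ≤ W (Additive.ofMul u)) : (u : k) ∈ S := by
    intro y hy
    induction hy using AddSubgroup.closure_induction with
    | mem y hy =>
      obtain ⟨v, rfl, hv⟩ := hy
      refine AddSubgroup.subset_closure ⟨u * v, by simp, ?_⟩
      rw [ofMul_mul, map_add]
      exact hv.trans_le (le_add_of_nonneg_left hu)
    | zero => simp
    | add y z _ _ hy hz => rw [mul_add]; exact add_mem hy hz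
    | neg y _ hy => rw [mul_neg]; exact neg_mem hy
  have htI : (t : k) ∈ I := AddSubgroup.subset_closure ⟨t, rfl, ht⟩
  have hval (x : k) : x ∈ S ∨ x⁻¹ ∈ S := by
    by_cases hx : x = 0
    · exact Or.inl (hx ▸ zero_mem S)
    rcases le_total 0 (W (Additive.ofMul (Units.mk0 x hx))) with h | h
    · exact Or.inl (hS _ h)
    · refine Or.inr (hS (Units.mk0 x hx)⁻¹ ?_)
      rw [ofMul_inv, map_neg]
      exact neg_nonneg.2 h
  refine ⟨ValuationSubring.ofSubring S hval, t, t.ne_zero, fun h => ?_, fun m hm => ?_, ?_⟩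
  · have hinv : (t : k)⁻¹ ∈ ValuationSubring.ofSubring S hval := h ▸ ValuationSubring.mem_top _
    have h1 := hI (hinv _ htI)
    rw [inv_mul_cancel₀ t.ne_zero] at h1
    exact hα.one_notMem_levelSpan h1
  · refine hS _ ?_
    rw [hW, powIndex_coe]
    exact nsmul_nonneg hm _
  · intro r hr x hx
    obtain ⟨n, hn, -⟩ := hα.one_add_mem_levelLE (hI (hr _ htI))
    rw [← hx] at hn
    exact Units.ext hn ▸ n.2

end ValuationRing

end LeveledMap

/-! ### The theorem -/

theorem mainTheorem5 {k : Type u} [Field k]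
    (hk : Algebra.trdeg (⊥ : Subfield k) k < Cardinal.aleph0)
    {D : Type v} [DivisionRing D] [Algebra k D] [FiniteDimensional k D]
    (N : Subgroup Dˣ) (hNnormal : N.Normal) (hNfin : N.FiniteIndex) (hN1 : (-1 : Dˣ) ∈ N)
    {Γ : Type w} [AddGroup Γ] [PartialOrder Γ] [AddLeftMono Γ] [AddRightMono Γ]
    (φ : Additive N →+ Γ) (hφ : LeveledMap.IsStronglyLeveled φ)
    (htot : ∀ a ∈ (LeveledMap.restrictBase k φ).range, ∀ b ∈ (LeveledMap.restrictBase k φ).range,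
      a ≤ b ∨ b ≤ a) :
    LeveledMap.IsStrongValuationLike (LeveledMap.restrictBase k φ).rangeRestrict ∧
    ∃ (Γ₀ : Type u) (_ : LinearOrderedCommGroupWithZero Γ₀) (v : Valuation k Γ₀),
      Function.Surjective v ∧
      LeveledMap.height Γ₀ˣ = 1 ∧
      LeveledMap.IsAssociated v (LeveledMap.restrictBase k φ) ∧
      LeveledMap.IsAdicallyOpen v (LeveledMap.interBase k N : Set kˣ) := by
  obtain ⟨α, hα⟩ := hφ
  -- Otherwise `D` is finite and an element of positive level has finite order.
  have hinf : Infinite k := by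
    by_contra hfin
    rw [not_infinite_iff_finite] at hfin
    have : Finite D := Module.finite_of_finite k
    obtain ⟨hα0, ⟨-, n, -, hn⟩, -⟩ := hα
    have h := nsmul_pos (hα0.trans_lt hn) (orderOf_pos n).ne'
    rw [← map_nsmul, ← ofMul_pow, pow_orderOf_eq_one, ofMul_one, map_zero] at h
    exact lt_irrefl _ h
  have hfi : (LeveledMap.interBase k N).FiniteIndex :=
    ⟨by
      rw [LeveledMap.interBase, Subgroup.index_comap]
      exact Subgroup.FiniteIndex.index_ne_zero (H := N.subgroupOf _)⟩
  obtain ⟨β, hβ⟩ := hα.exists_isSLevel_restrictBase htot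
  refine ⟨⟨fun a b => htot a a.2 b b.2, β, hβ⟩, ?_⟩
  let Δ := (LeveledMap.restrictBase k φ).range
  -- `Γ` may be non-commutative, but `Δ` is an image of a subgroup of `kˣ`.
  let _ : AddCommGroup Δ :=
    { (inferInstance : AddGroup Δ) with
      add_comm := by
        rintro ⟨_, a, rfl⟩ ⟨_, b, rfl⟩
        refine Subtype.ext ?_
        change LeveledMap.restrictBase k φ a + LeveledMap.restrictBase k φ b =
          LeveledMap.restrictBase k φ b + LeveledMap.restrictBase k φ a
        rw [← map_add, ← map_add, add_comm] }
  let _ : LinearOrder Δ :=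
    { (inferInstance : PartialOrder Δ) with
      le_total := fun a b => htot a a.2 b b.2
      toDecidableLE := Classical.decRel _ }
  have : IsOrderedAddMonoid Δ :=
    { add_le_add_left := fun a b h c => add_le_add_left (α := Γ) h (c : Γ) }
  obtain ⟨R, t, ht, hR, hMR, hopen⟩ := LeveledMap.IsSLevel.exists_valuationSubring (Δ := Δ) hβ
    (LeveledMap.restrictBase k φ).rangeRestrict_surjective
  obtain ⟨V, hRV, hV⟩ := R.exists_le_isCoatom hk hR
  refine ⟨V.ValueGroup, inferInstance, V.valuation, V.valuation_surjective, ?_, ?_, ?_⟩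
  · have : Nontrivial V.ValueGroupˣ := by
      obtain ⟨x, -, hx⟩ := SetLike.exists_of_lt (lt_top_iff_ne_top.2 hV.1)
      have h1 := (V.one_lt_valuation_iff x).2 hx
      refine ⟨1, Units.mk0 (V.valuation x) (zero_lt_one.trans h1).ne', fun h => h1.ne ?_⟩
      exact congrArg Units.val h
    refine LeveledMap.height_eq_one fun a b ha => ?_
    obtain ⟨n, hn⟩ := ValuationSubring.exists_le_pow_of_isCoatom hV (a := a) (b := b) ha
    exact ⟨n, hn⟩
  · intro m hm
    exact (V.valuation_le_one_iff _).2 (hRV (hMR m hm))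
  · refine LeveledMap.isAdicallyOpen_subgroup V _ ht fun x hx => ?_
    refine hopen (((x : k) - 1) / t) ?_ x (by field_simp; ring)
    rcases eq_or_ne ((x : k) - 1) 0 with hx1 | hx1
    · rw [hx1, zero_div]
      exact zero_mem R
    -- If the quotient is not in `R`, its inverse is in `R`, hence in `V`, contradicting the strict
    -- inequality `hx`. So the neighbourhood found for `R` contains one for the coarser `V`.
    by_contra hnot
    have hinv := hRV ((R.mem_or_inv_mem _).resolve_left hnot)
    have hx0 : 0 < V.valuation ((x : k) - 1) := by rwa [zero_lt_iff, Ne, map_eq_zero]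
    rw [← V.valuation_le_one_iff, inv_div, map_div₀, div_le_one₀ hx0] at hinv
    exact hinv.not_gt hx
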